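/- Let $1\le k\le n$ be integers and $\mathfrak g=\mathfrak{gl}(n,\mathbb C)$, identified with $\mathfrak g^*$ by the trace pairing $\langle A,\xi\rangle=\operatorname{Tr}(A\xi)$. For $A\in\mathfrak g$ let $\mathcal O_A=\{gAg^{-1}: g\in GL(n,\mathbb C)\}$ be its (co)adjoint orbit, with tangent space $T_B\mathcal O_A=\{[\xi,B]:\xi\in\mathfrak g\}$ and Kirillov–Kostant–Souriau symplectic form $\omega_B([\xi,B],[\eta,B])=\operatorname{Tr}(B[\xi,\eta])$. Let $p_1,\dots,p_k\in\mathfrak g$ be projectors ($p_i^2=p_i$) of rank $1$ and let $P\in\mathfrak g$ be a projector ($P^2=P$) of rank $k$. Put $Y=\mathcal O_{p_1}\times\dots\times\mathcal O_{p_k}$, equip $Y\times\mathcal O_{-P}$ with the sum of the pullbacks of the symplectic forms of its factors, and let $X=\mu^{-1}(0)$ be the zero fiber of the moment map $$\mu:Y\times\mathcal O_{-P}\to\mathfrak g^*\cong\mathfrak g,\qquad \mu(q_1,\dots,q_k,-Q)=q_1+\dots+q_k-Q,$$ of the diagonal conjugation action of $GL(n,\mathbb C)$. Then $$X=\Bigl\{\bigl(q_1,\dots,q_k,-\textstyle\sum_i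 q_i\bigr): q_i^2=q_i,\ \operatorname{rank} q_i=1,\ q_iq_j=0\ \text{for } i\ne j\Bigr\},$$ and $X$ is a nonempty smooth closed Lagrangian subvariety of $Y\times\mathcal O_{-P}$. That is, $X$ is a Zariski closed set of tuples of matrices contained in $Y\times\mathcal O_{-P}$, and at each of its points it is a complex submanifold whose tangent space is isotropic for the symplectic form of $Y\times\mathcal O_{-P}$ and has half the dimension of the tangent space of $Y\times\mathcal O_{-P}$. -/

import Mathlib

attribute [local instance] Matrix.normedAddCommGroup Matrix.normedSpace

noncomputable section

namespace CoadjointOrbits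

/-- The Lie algebra `gl(n) = gl(n, ℂ)`. It is identified with its dual by the invariant pairing
`⟨A, ξ⟩ = Tr (A ξ)`; under this identification the coadjoint action of `GL(n)` is conjugation. -/
abbrev Gl (n : ℕ) : Type := Matrix (Fin n) (Fin n) ℂ

/-- The coadjoint orbit `O_A = {g A g⁻¹ | g ∈ GL(n)}`. -/
def orbit {n : ℕ} (A : Gl n) : Set (Gl n) :=
  {B | ∃ g : GL (Fin n) ℂ, B = (g : Gl n) * A * ((g⁻¹ : GL (Fin n) ℂ) : Gl n)}

/-- The derivative `ξ ↦ ξ A - A ξ` at `1` of the orbit map `g ↦ g A g⁻¹`. -/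
def infAction {n : ℕ} (A : Gl n) : Gl n →ₗ[ℂ] Gl n where
  toFun ξ := ξ * A - A * ξ
  map_add' ξ η := by rw [add_mul, mul_add]; abel
  map_smul' c ξ := by simp [smul_sub]

/-- The tangent space at `A` of the orbit through `A`: all `[ξ, A]` with `ξ ∈ gl(n)`. -/
def orbitTangent {n : ℕ} (A : Gl n) : Submodule ℂ (Gl n) := LinearMap.range (infAction A)

/-- Value of the Kirillov-Kostant-Souriau form at `A`: for `v = [ξ, A]` and `w = [η, A]` it is
`⟨A, [ξ, η]⟩ = Tr (A (ξ η - η ξ))`; see `kksFun_eq` for independence of the choices. -/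
def kksFun {n : ℕ} (A : Gl n) (v w : orbitTangent A) : ℂ :=
  Matrix.trace (A * (v.2.choose * w.2.choose - w.2.choose * v.2.choose))

theorem trace_eq {n : ℕ} (A ξ η : Gl n) :
    Matrix.trace (A * (ξ * η - η * ξ)) = Matrix.trace (ξ * infAction A η) := by
  simp only [infAction, LinearMap.coe_mk, AddHom.coe_mk, mul_sub, Matrix.trace_sub]
  rw [Matrix.trace_mul_comm A (ξ * η), Matrix.trace_mul_comm A (η * ξ), mul_assoc, mul_assoc,
    Matrix.trace_mul_comm η (ξ * A), mul_assoc, Matrix.trace_mul_comm ξ (η * A), mul_assoc,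
    Matrix.trace_mul_comm η (A * ξ), Matrix.trace_mul_comm ξ (A * η), mul_assoc,
    Matrix.trace_mul_comm A (ξ * η), mul_assoc, mul_assoc, Matrix.trace_mul_comm A (η * ξ),
    mul_assoc]

theorem trace_eq' {n : ℕ} (A ξ η : Gl n) :
    Matrix.trace (A * (ξ * η - η * ξ)) = - Matrix.trace (η * infAction A ξ) := by
  rw [← trace_eq, ← Matrix.trace_neg, ← mul_neg, neg_sub]

theorem kksFun_eq {n : ℕ} (A ξ η : Gl n) (v w : orbitTangent A)
    (hv : infAction A ξ = v) (hw : infAction A η = w) :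
    kksFun A v w = Matrix.trace (A * (ξ * η - η * ξ)) := by
  unfold kksFun
  rw [trace_eq, w.2.choose_spec, ← hw, ← trace_eq, trace_eq', v.2.choose_spec, ← hv, ← trace_eq']

/-- The Kirillov-Kostant-Souriau form at `A`, a bilinear form on the tangent space of the orbit. -/
def kks {n : ℕ} (A : Gl n) : LinearMap.BilinForm ℂ (orbitTangent A) :=
  LinearMap.mk₂ ℂ (kksFun A)
    (by
      rintro ⟨_, ξ, rfl⟩ ⟨_, ξ', rfl⟩ ⟨_, η, rfl⟩
      rw [kksFun_eq A (ξ + ξ') η _ _ (map_add _ _ _) rfl, kksFun_eq A ξ η _ _ rfl rfl,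
        kksFun_eq A ξ' η _ _ rfl rfl]
      rw [trace_eq, trace_eq, trace_eq]
      rw [add_mul, Matrix.trace_add])
    (by
      rintro c ⟨_, ξ, rfl⟩ ⟨_, η, rfl⟩
      rw [kksFun_eq A (c • ξ) η _ _ (map_smul _ _ _) rfl, kksFun_eq A ξ η _ _ rfl rfl]
      rw [trace_eq, trace_eq]
      rw [smul_mul_assoc, Matrix.trace_smul])
    (by
      rintro ⟨_, ξ, rfl⟩ ⟨_, η, rfl⟩ ⟨_, η', rfl⟩
      rw [kksFun_eq A ξ (η + η') _ _ rfl (map_add _ _ _), kksFun_eq A ξ η _ _ rfl rfl,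
        kksFun_eq A ξ η' _ _ rfl rfl]
      rw [trace_eq, trace_eq, trace_eq]
      rw [map_add, mul_add, Matrix.trace_add])
    (by
      rintro c ⟨_, ξ, rfl⟩ ⟨_, η, rfl⟩
      rw [kksFun_eq A ξ (c • η) _ _ rfl (map_smul _ _ _), kksFun_eq A ξ η _ _ rfl rfl]
      rw [trace_eq, trace_eq]
      rw [map_smul, mul_smul_comm, Matrix.trace_smul])

theorem kks_eq {n : ℕ} (A ξ η : Gl n) (v w : orbitTangent A)
    (hv : infAction A ξ = v) (hw : infAction A η = w) :
    kks A v w = Matrix.trace (A * (ξ * η - η * ξ)) :=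
  kksFun_eq A ξ η v w hv hw

/-- The Kirillov-Kostant-Souriau form is nondegenerate. -/
theorem kks_nondegenerate {n : ℕ} (A : Gl n) (w : orbitTangent A)
    (h : ∀ v, kks A v w = 0) : w = 0 := by
  obtain ⟨_, η, rfl⟩ := w
  have h1 : infAction A η = 0 := by
    refine Matrix.ext_iff_trace_mul_left.mpr fun ξ => ?_
    have := h ⟨infAction A ξ, ξ, rfl⟩
    rw [kks_eq A ξ η _ _ rfl rfl, trace_eq] at this
    simpa using this
  exact Subtype.ext h1

/-- The product of the coadjoint orbits of the matrices `A a`. -/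
def orbitProd {n : ℕ} {ι : Type} (A : ι → Gl n) : Set (ι → Gl n) :=
  {x | ∀ a, x a ∈ orbit (A a)}

/-- The tangent space at `x` of the product of the orbits through the components of `x`. -/
def prodTangent {n : ℕ} {ι : Type} (x : ι → Gl n) : Submodule ℂ (ι → Gl n) :=
  Submodule.pi Set.univ fun a => orbitTangent (x a)

/-- The symplectic form of a product of coadjoint orbits: the sum of the pullbacks of the
Kirillov-Kostant-Souriau forms of the factors. -/
def prodForm {n : ℕ} {ι : Type} [Fintype ι] (x : ι → Gl n) (v w : prodTangent x) : ℂ :=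
  ∑ a, kks (x a) ⟨v.1 a, v.2 a trivial⟩ ⟨w.1 a, w.2 a trivial⟩

/-- The moment map of the diagonal conjugation action of `GL(n)` on a product of orbits. -/
def momentMap {n : ℕ} {ι : Type} [Fintype ι] (x : ι → Gl n) : Gl n := ∑ a, x a

/-- The defining property of a moment map: contracting the symplectic form with the vector field
`x ↦ ([ξ, x a])ₐ` generated by `ξ` gives the differential of `x ↦ ⟨momentMap x, ξ⟩`. -/
theorem momentMap_spec {n : ℕ} {ι : Type} [Fintype ι] (x : ι → Gl n) (ξ : Gl n)
    (w : prodTangent x) :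
    prodForm x ⟨fun a => infAction (x a) ξ, fun _ _ => ⟨ξ, rfl⟩⟩ w =
      Matrix.trace (momentMap w.1 * ξ) := by
  unfold prodForm momentMap
  rw [Finset.sum_mul, Matrix.trace_sum]
  refine Finset.sum_congr rfl fun a _ => ?_
  obtain ⟨η, hη⟩ := w.2 a trivial
  rw [kks_eq (x a) ξ η _ _ rfl hη, trace_eq, hη, Matrix.trace_mul_comm]

/-- Zariski closed subsets of the affine space of families of matrices: the common zero sets of
families of polynomials in the matrix entries. -/
def IsZariskiClosed {n : ℕ} {ι : Type} (X : Set (ι → Gl n)) : Prop :=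
  ∃ S : Set (MvPolynomial (ι × Fin n × Fin n) ℂ),
    X = {x | ∀ f ∈ S, MvPolynomial.eval (fun c => x c.1 c.2.1 c.2.2) f = 0}

/-- Near its point `x`, the set `X` is a complex submanifold of `E` with tangent space `T`: in a
neighbourhood of `x` it is the zero set of a holomorphic map whose differential at `x` is
surjective with kernel `T`. -/
def IsSubmanifoldAt {E : Type} [NormedAddCommGroup E] [NormedSpace ℂ E]
    (X : Set E) (x : E) (T : Submodule ℂ E) : Prop :=
  x ∈ X ∧ ∃ (c : ℕ) (U : Set E) (F : E → Fin c → ℂ),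
    IsOpen U ∧ x ∈ U ∧ DifferentiableOn ℂ F U ∧
    X ∩ U = {y ∈ U | F y = 0} ∧
    Function.Surjective (fderiv ℂ F x) ∧
    T = LinearMap.ker (fderiv ℂ F x : E →ₗ[ℂ] Fin c → ℂ)

/-- `T` is a Lagrangian subspace of the tangent space at `x` of the product of the orbits through
the components of `x`: it is isotropic and of half dimension. -/
def IsLagrangianSubspace {n : ℕ} {ι : Type} [Fintype ι] (x : ι → Gl n)
    (T : Submodule ℂ (ι → Gl n)) : Prop :=
  ∃ hT : T ≤ prodTangent x,
    (∀ (v w : ι → Gl n) (hv : v ∈ T) (hw : w ∈ T), prodForm x ⟨v, hT hv⟩ ⟨w, hT hw⟩ = 0) ∧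
    2 * Module.finrank ℂ T = Module.finrank ℂ (prodTangent x)

/-- `X` is a smooth closed Lagrangian subvariety of the product of the coadjoint orbits of the
matrices `A a`: a Zariski closed set contained in the product of the orbits which at each of its
points is a complex submanifold with Lagrangian tangent space. -/
structure IsLagrangianSubvariety {n : ℕ} {ι : Type} [Fintype ι] (A : ι → Gl n)
    (X : Set (ι → Gl n)) : Prop where
  subset : X ⊆ orbitProd A
  closed : IsZariskiClosed X
  lagrangian : ∀ x ∈ X, ∃ T, IsSubmanifoldAt X x T ∧ IsLagrangianSubspace x T

/-- The matrices `p 1, …, p k, -P`, indexed by `Option (Fin k)`: the component `some i` is `p i`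
and the component `none` is `-P`. -/
def withNeg {n k : ℕ} (p : Fin k → Gl n) (P : Gl n) : Option (Fin k) → Gl n
  | some i => p i
  | none => -P

/-- The fibre over `0` of the moment map on a product of coadjoint orbits. -/
def zeroFiber {n : ℕ} {ι : Type} [Fintype ι] (A : ι → Gl n) : Set (ι → Gl n) :=
  {x ∈ orbitProd A | momentMap x = 0}

/-- Systems of `k` pairwise orthogonal projectors of rank `1`, together with minus their sum. -/
def orthogonalSystems (n k : ℕ) : Set (Option (Fin k) → Gl n) :=
  {x | ∃ q : Fin k → Gl n, (∀ i, q i * q i = q i ∧ (q i).rank = 1) ∧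
    (∀ i j, i ≠ j → q i * q j = 0) ∧ x = withNeg q (∑ i, q i)}

end CoadjointOrbits

end

/-!
Idempotents with idempotent sum are orthogonal in characteristic zero: rank equals trace, so the
ranks add up, and the range of the sum is the direct sum of the ranges. Hence the zero fibre `X`
consists of the systems of orthogonal projectors. Adding `1` to the last component turns a point
`x` of `X` into a complete system of orthogonal idempotents `e`.

The symplectic complement of the orbit directions `([ξ, xₐ])ₐ` is the kernel of `dμ`, and these
directions lie in `ker dμ` because `μ x = 0`. Conversely, if `w` is tangent with `∑ wₐ = 0`, then
`ξ = ∑ wₐ eₐ` solves `[ξ, xₐ] = wₐ`, so the orbit directions form a Lagrangian subspace.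

If `f` is the complete system attached to a nearby point `y` of `X`, then `S = ∑ fₐ eₐ` is close
to `1` and conjugates `x` into `y`. The formula for `S` makes sense for every `y` near `x`, so
`y ↦ S x S⁻¹` is a holomorphic retraction onto `X`, whence `X` is smooth at `x`; its differential
`w ↦ ([∑ w_b e_b, xₐ])ₐ` has the orbit directions as its range.
-/

noncomputable section

namespace CoadjointOrbits

open Module Matrix

section Idempotents

variable {K V ι m : Type*} [Field K] [AddCommGroup V] [Module K V] [FiniteDimensional K V]

theorem isConj_of_isIdempotentElem {f g : End K V} (hf : IsIdempotentElem f)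
    (hg : IsIdempotentElem g) (hrank : finrank K f.range = finrank K g.range) : IsConj f g := by
  have hker : finrank K f.ker = finrank K g.ker := by
    have hf' := f.finrank_range_add_finrank_ker
    have hg' := g.finrank_range_add_finrank_ker
    lia
  let φf := f.range.prodEquivOfIsCompl f.ker (LinearMap.IsIdempotentElem.isCompl hf)
  let φg := g.range.prodEquivOfIsCompl g.ker (LinearMap.IsIdempotentElem.isCompl hg)
  let φ : V ≃ₗ[K] V := φf.symm ≪≫ₗ
    (LinearEquiv.ofFinrankEq _ _ hrank).prodCongr (LinearEquiv.ofFinrankEq _ _ hker) ≪≫ₗ φg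
  refine ⟨LinearMap.GeneralLinearGroup.ofLinearEquiv φ, LinearMap.ext fun v => ?_⟩
  obtain ⟨⟨u, w⟩, rfl⟩ := φf.surjective v
  have hfu : f (φf (u, w)) = φf (u, 0) := by
    simp [φf, (LinearMap.IsIdempotentElem.mem_range_iff hf).mp u.2]
  have hgu : ∀ u w, g (φg (u, w)) = φg (u, 0) := fun u w => by
    simp [φg, (LinearMap.IsIdempotentElem.mem_range_iff hg).mp u.2]
  change φ (f (φf (u, w))) = g (φ (φf (u, w)))
  simp [hfu, φ, hgu]

theorem trace_eq_finrank_range_of_isIdempotentElem {f : End K V} (hf : IsIdempotentElem f) :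
    LinearMap.trace K V f = finrank K f.range :=
  (LinearMap.IsIdempotentElem.isProj_range f hf).trace

theorem finrank_range_sum_of_isIdempotentElem [CharZero K] [Fintype ι] {f : ι → End K V}
    (hf : ∀ i, IsIdempotentElem (f i)) (hsum : IsIdempotentElem (∑ i, f i)) :
    finrank K (∑ i, f i).range = ∑ i, finrank K (f i).range := by
  have htrace := trace_eq_finrank_range_of_isIdempotentElem hsum
  simp only [map_sum, trace_eq_finrank_range_of_isIdempotentElem (hf _)] at htrace
  exact_mod_cast htrace.symm

theorem orthogonalIdempotents_of_isIdempotentElem_sum [CharZero K] [Fintype ι] {f : ι → End K V}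
    (hf : ∀ i, IsIdempotentElem (f i)) (hsum : IsIdempotentElem (∑ i, f i)) :
    OrthogonalIdempotents f := by
  classical
  let Φ : (∀ i, (f i).range) →ₗ[K] V := LinearMap.lsum K _ K fun i => (f i).range.subtype
  have hΦ : ∀ v, Φ (fun i => (f i).rangeRestrict v) = (∑ i, f i) v := fun v => by simp [Φ]
  have hrange : (∑ i, f i).range = Φ.range := by
    refine Submodule.eq_of_le_of_finrank_le ?_ (Φ.finrank_range_le.trans_eq ?_)
    · rintro _ ⟨v, rfl⟩
      exact ⟨_, hΦ v⟩
    · rw [finrank_pi_fintype, finrank_range_sum_of_isIdempotentElem hf hsum]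
  have hinj : Function.Injective Φ := by
    rw [← LinearMap.ker_eq_bot, ← Submodule.finrank_eq_zero (R := K)]
    have h := Φ.finrank_range_add_finrank_ker
    rw [← hrange, finrank_pi_fintype, finrank_range_sum_of_isIdempotentElem hf hsum] at h
    lia
  refine ⟨hf, fun i j hij => LinearMap.ext fun v => ?_⟩
  have hsingle : Φ (Pi.single j ((f j).rangeRestrict v)) = f j v :=
    LinearMap.lsum_piSingle ..
  have hfix : (∑ i, f i) (f j v) = f j v :=
    (LinearMap.IsIdempotentElem.mem_range_iff hsum).mp (hrange ▸ ⟨_, hsingle⟩)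
  have h := congrFun (hinj ((hΦ _).trans (hfix.trans hsingle.symm))) i
  rw [Pi.single_eq_of_ne hij] at h
  exact congrArg Subtype.val h

variable [Fintype m]

theorem trace_eq_rank_of_isIdempotentElem {e : Matrix m m K} (he : IsIdempotentElem e) :
    e.trace = e.rank := by
  classical
  rw [← trace_toLin'_eq]
  exact trace_eq_finrank_range_of_isIdempotentElem (he.map toLinAlgEquiv')

theorem rank_sum_of_isIdempotentElem [CharZero K] [Fintype ι] {e : ι → Matrix m m K}
    (he : ∀ i, IsIdempotentElem (e i)) (hsum : IsIdempotentElem (∑ i, e i)) :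
    (∑ i, e i).rank = ∑ i, (e i).rank := by
  classical
  let φ := toLinAlgEquiv' (R := K) (n := m)
  have hrank := finrank_range_sum_of_isIdempotentElem (fun i => (he i).map φ)
    (map_sum φ e _ ▸ hsum.map φ)
  rwa [← map_sum] at hrank

variable [DecidableEq m]

theorem isConj_iff_of_isIdempotentElem {e f : Matrix m m K} (he : IsIdempotentElem e) :
    IsConj e f ↔ IsIdempotentElem f ∧ f.rank = e.rank := by
  constructor
  · rintro ⟨u, hu⟩
    have hf : ConjAct.toConjAct u • e = f := by
      rw [ConjAct.units_smul_def, ConjAct.ofConjAct_toConjAct, hu.eq, Units.mul_inv_cancel_right]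
    subst hf
    refine ⟨he.map (MulSemiringAction.toRingHom _ _ (ConjAct.toConjAct u)), ?_⟩
    have hdet : ∀ c : (Matrix m m K)ˣ, IsUnit (c : Matrix m m K).det := fun c =>
      (isUnit_iff_isUnit_det _).mp c.isUnit
    rw [ConjAct.units_smul_def, rank_mul_eq_left_of_isUnit_det _ _ (hdet _),
      rank_mul_eq_right_of_isUnit_det _ _ (hdet _)]
  · rintro ⟨hf, hrank⟩
    simpa using (toLinAlgEquiv' (R := K) (n := m)).symm.toMonoidHom.map_isConj
      (isConj_of_isIdempotentElem (he.map toLinAlgEquiv') (hf.map toLinAlgEquiv') hrank.symm)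

theorem orthogonalIdempotents_matrix_of_isIdempotentElem_sum [CharZero K] [Fintype ι]
    {e : ι → Matrix m m K} (he : ∀ i, IsIdempotentElem (e i))
    (hsum : IsIdempotentElem (∑ i, e i)) : OrthogonalIdempotents e := by
  let φ := toLinAlgEquiv' (R := K) (n := m)
  refine (OrthogonalIdempotents.map_injective_iff (φ : Matrix m m K →+* End K (m → K))
    φ.injective).mp ?_
  exact orthogonalIdempotents_of_isIdempotentElem_sum (fun i => (he i).map φ)
    (map_sum φ e _ ▸ hsum.map φ)

theorem exists_orthogonalIdempotents_rank_eq [Fintype ι] {r : ι → ℕ}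
    (hr : ∑ i, r i ≤ Fintype.card m) :
    ∃ q : ι → Matrix m m K, OrthogonalIdempotents q ∧ ∀ i, (q i).rank = r i := by
  classical
  obtain ⟨f⟩ : Nonempty ((Σ i, Fin (r i)) ↪ m) :=
    Function.Embedding.nonempty_of_card_le (by simpa using hr)
  let s : ι → Set m := fun i => Set.range fun t => f ⟨i, t⟩
  have hcard : ∀ i, Fintype.card (s i) = r i := fun i =>
    (Set.card_range_of_injective (f.injective.comp sigma_mk_injective)).trans (Fintype.card_fin _)
  have hdisj : Pairwise fun i j => Disjoint (s i) (s j) := fun i j hij => by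
    simp [s, Set.disjoint_left, hij.symm]
  have hs : OrthogonalIdempotents fun i => (s i).indicator (1 : m → K) :=
    ⟨fun i => by rw [IsIdempotentElem, ← Set.inter_indicator_one, Set.inter_self], fun i j hij => by
      beta_reduce
      rw [← Set.inter_indicator_one, (hdisj hij).inter_eq, Set.indicator_empty']⟩
  refine ⟨_, hs.map (diagonalRingHom m K), fun i => ?_⟩
  simp [rank_diagonal, hcard]

end Idempotents

section IdempotentRing

variable {R ι : Type*} [Ring R] [Fintype ι] {e f : ι → R}

theorem sum_mul_mul_of_orthogonalIdempotents (he : OrthogonalIdempotents e) (f : ι → R) (a : ι) :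
    (∑ b, f b * e b) * e a = f a * e a := by
  classical
  simp [Finset.sum_mul, mul_assoc, he.mul_eq]

theorem mul_sum_mul_of_orthogonalIdempotents (hf : OrthogonalIdempotents f) (e : ι → R) (a : ι) :
    f a * ∑ b, f b * e b = f a * e a := by
  classical
  simp [Finset.mul_sum, ← mul_assoc, hf.mul_eq]

theorem commutator_sum_mul_of_orthogonalIdempotents (he : OrthogonalIdempotents e) {w : ι → R}
    (hw : ∀ a, e a * w a + w a * e a = w a) (hsum : ∑ a, w a = 0) (a : ι) :
    (∑ b, w b * e b) * e a - e a * ∑ b, w b * e b = w a := by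
  classical
  have hmul : e a * ∑ b, w b * e b = -(e a * w a) := by
    calc e a * ∑ b, w b * e b = ∑ b, (e a * w b - e a * e b * w b) := by
          rw [Finset.mul_sum]
          refine Finset.sum_congr rfl fun b _ => ?_
          rw [mul_assoc, ← mul_sub, ← eq_sub_of_add_eq' (hw b)]
      _ = -(e a * w a) := by
          simp [Finset.sum_sub_distrib, ← Finset.mul_sum, hsum, he.mul_eq]
  rw [sum_mul_mul_of_orthogonalIdempotents he, hmul, sub_neg_eq_add, add_comm, hw]

end IdempotentRing

section Completion

variable {n : ℕ} {κ : Type}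

/-- The family `x` with the identity matrix added to its component at `none`. For pairwise
orthogonal projectors `qᵢ` it turns `(q₁, …, q_k, -∑ qᵢ)` into a complete system of orthogonal
idempotents without changing any commutator. -/
def completed (x : Option κ → Gl n) : Option κ → Gl n
  | none => x none + 1
  | some i => x (some i)

theorem infAction_completed (x : Option κ → Gl n) (a : Option κ) :
    infAction (completed x a) = infAction (x a) := by
  cases a <;> ext1 ξ <;> simp [completed, infAction, mul_add, add_mul]

theorem mul_add_mul_of_mem_orbitTangent {e w : Gl n} (he : IsIdempotentElem e)
    (hw : w ∈ orbitTangent e) : e * w + w * e = w := by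
  obtain ⟨ξ, rfl⟩ := hw
  change e * (ξ * e - e * ξ) + (ξ * e - e * ξ) * e = ξ * e - e * ξ
  rw [mul_sub, sub_mul, mul_assoc ξ, ← mul_assoc e e, he.eq, mul_assoc]
  abel

variable [Fintype κ]

theorem momentMap_eq_zero_iff {x : Option κ → Gl n} :
    momentMap x = 0 ↔ x none = -∑ i, x (some i) := by
  rw [momentMap, Fintype.sum_option, add_eq_zero_iff_eq_neg]

theorem completeOrthogonalIdempotents_completed {x : Option κ → Gl n} (hx : momentMap x = 0)
    (he : OrthogonalIdempotents fun i => x (some i)) :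
    CompleteOrthogonalIdempotents (completed x) := by
  have hcompl : completed x = (·.elim (1 - ∑ i, x (some i)) fun i => x (some i)) := by
    funext a
    cases a <;> simp [completed, momentMap_eq_zero_iff.mp hx, neg_add_eq_sub]
  exact hcompl ▸ CompleteOrthogonalIdempotents.option he

theorem infAction_sum_mul_completed {x w : Option κ → Gl n}
    (hx : OrthogonalIdempotents (completed x)) (hw : w ∈ prodTangent x) (hw0 : momentMap w = 0)
    (a : Option κ) : infAction (x a) (∑ b, w b * completed x b) = w a := by
  rw [← infAction_completed]
  refine commutator_sum_mul_of_orthogonalIdempotents hx (fun b => ?_) hw0 a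
  refine mul_add_mul_of_mem_orbitTangent (hx.idem b) ?_
  rw [orbitTangent, infAction_completed]
  exact hw b trivial

end Completion

section Lagrangian

variable {n : ℕ} {ι : Type}

/-- The infinitesimal diagonal conjugation action `ξ ↦ ([ξ, x a])ₐ` at `x`; its range is the tangent
space of the orbit of `x` under simultaneous conjugation. -/
def diagAction (x : ι → Gl n) : Gl n →ₗ[ℂ] prodTangent x :=
  (LinearMap.pi fun a => infAction (x a)).codRestrict _ fun ξ _ _ => ⟨ξ, rfl⟩

variable [Fintype ι] {x : ι → Gl n}

/-- `prodForm x` as a bilinear form, so that symplectic complements can be taken. -/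
def prodBilin (x : ι → Gl n) : LinearMap.BilinForm ℂ (prodTangent x) :=
  let proj (a : ι) : prodTangent x →ₗ[ℂ] orbitTangent (x a) :=
    (LinearMap.proj a ∘ₗ (prodTangent x).subtype).codRestrict _ fun v => v.2 a trivial
  ∑ a, (kks (x a)).compl₁₂ (proj a) (proj a)

theorem prodBilin_apply (v w : prodTangent x) : prodBilin x v w = prodForm x v w := by
  simp only [prodBilin, prodForm, LinearMap.sum_apply, LinearMap.compl₁₂_apply]
  rfl

theorem kks_self (A : Gl n) (v : orbitTangent A) : kks A v v = 0 := by
  obtain ⟨_, ξ, rfl⟩ := v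
  rw [kks_eq A ξ ξ _ _ rfl rfl, sub_self, mul_zero, trace_zero]

theorem isAlt_prodBilin (x : ι → Gl n) : (prodBilin x).IsAlt := fun v => by
  simp [prodBilin_apply, prodForm, kks_self]

theorem nondegenerate_prodBilin (x : ι → Gl n) : (prodBilin x).Nondegenerate := by
  classical
  refine (isAlt_prodBilin x).isRefl.nondegenerate_iff_separatingRight.mpr fun w hw => ?_
  refine Subtype.ext (funext fun a => congrArg Subtype.val
    (kks_nondegenerate (x a) ⟨w.1 a, w.2 a trivial⟩ fun v => ?_))
  have hv : Pi.single a v.1 ∈ prodTangent x := Submodule.le_comap_single_pi _ v.2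
  rw [← hw ⟨_, hv⟩, prodBilin_apply, prodForm, Finset.sum_eq_single a]
  · simp
  · intro b _ hb
    simp only [Pi.single_eq_of_ne hb]
    exact LinearMap.map_zero₂ _ _
  · simp

theorem momentMap_diagAction (x : ι → Gl n) (ξ : Gl n) :
    momentMap (diagAction x ξ).1 = infAction (momentMap x) ξ := by
  simp [momentMap, infAction, diagAction, Finset.mul_sum, Finset.sum_mul]

theorem mem_orthogonal_range_diagAction (x : ι → Gl n) (w : prodTangent x) :
    w ∈ (prodBilin x).orthogonal (diagAction x).range ↔ momentMap w.1 = 0 := by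
  have hpair : ∀ ξ, prodBilin x (diagAction x ξ) w = (momentMap w.1 * ξ).trace := fun ξ =>
    (prodBilin_apply _ _).trans (momentMap_spec x ξ w)
  rw [LinearMap.BilinForm.mem_orthogonal_iff, Matrix.ext_iff_trace_mul_right]
  simp [hpair]

theorem isLagrangianSubspace_map_subtype {W : Submodule ℂ (prodTangent x)}
    (hW : (prodBilin x).orthogonal W = W) :
    IsLagrangianSubspace x (W.map (prodTangent x).subtype) := by
  refine ⟨Submodule.map_subtype_le _ _, ?_, ?_⟩
  · rintro _ _ ⟨v, hv, rfl⟩ ⟨w, hw, rfl⟩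
    rw [← hW] at hw
    exact (prodBilin_apply _ _).symm.trans (hw v hv)
  · have hdim := LinearMap.BilinForm.finrank_add_finrank_orthogonal' (B := prodBilin x) W
    rw [(nondegenerate_prodBilin x).ker_eq_bot, inf_bot_eq, finrank_bot, hW] at hdim
    rw [Submodule.finrank_map_subtype_eq, two_mul, hdim, add_zero]

theorem isLagrangianSubspace_range_diagAction (hx : momentMap x = 0)
    (hker : ∀ w : prodTangent x, momentMap w.1 = 0 → w ∈ (diagAction x).range) :
    IsLagrangianSubspace x ((diagAction x).range.map (prodTangent x).subtype) := by
  refine isLagrangianSubspace_map_subtype (Submodule.ext fun w => ?_)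
  refine (mem_orthogonal_range_diagAction x w).trans ⟨hker w, ?_⟩
  rintro ⟨ξ, rfl⟩
  simp [momentMap_diagAction, hx, infAction]

theorem isLagrangianSubspace_of_orthogonalIdempotents {κ : Type} [Fintype κ]
    {x : Option κ → Gl n} (hx : momentMap x = 0) (he : OrthogonalIdempotents (completed x)) :
    IsLagrangianSubspace x ((diagAction x).range.map (prodTangent x).subtype) :=
  isLagrangianSubspace_range_diagAction hx fun w hw =>
    ⟨_, Subtype.ext (funext (infAction_sum_mul_completed he w.2 hw))⟩

end Lagrangian

section Retraction

open Filter Topology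

section Differentiation

variable {𝕜 E : Type*} [NontriviallyNormedField 𝕜] [NormedAddCommGroup E] [NormedSpace 𝕜 E]
  {r : E → E} {D : E →L[𝕜] E} {x : E}

theorem isIdempotentElem_of_hasFDerivAt_retraction (hr : HasFDerivAt r D x) (hx : r x = x)
    (hidem : ∀ᶠ y in 𝓝 x, r (r y) = r y) : IsIdempotentElem D := by
  have hcomp : HasFDerivAt (r ∘ r) (D ∘L D) x := HasFDerivAt.comp x (hx.symm ▸ hr) hr
  exact hcomp.unique (hr.congr_of_eventuallyEq hidem)

theorem eventually_eq_of_hasStrictFDerivAt_retraction (hr : HasStrictFDerivAt r D x) (hx : r x = x)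
    (hidem : ∀ᶠ y in 𝓝 x, r (r y) = r y) :
    ∀ᶠ y in 𝓝 x, D (y - r y) = y - r y → r y = y := by
  have hpair : Tendsto (fun y => (y, r y)) (𝓝 x) (𝓝 (x, x)) := by
    simpa only [ContinuousAt, id, hx] using continuousAt_id.prodMk hr.continuousAt
  filter_upwards [hidem, (hr.isLittleO.comp_tendsto hpair).def one_half_pos] with y hy hsmall hDy
  have hle : ‖y - r y‖ ≤ 1 / 2 * ‖y - r y‖ := by
    simpa [hy, ← map_sub, hDy, norm_sub_rev] using hsmall
  have hzero : ‖y - r y‖ = 0 := by linarith [norm_nonneg (y - r y)]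
  exact (sub_eq_zero.mp (norm_eq_zero.mp hzero)).symm

end Differentiation

theorem exists_surjective_ker_eq {K V : Type*} [Field K] [AddCommGroup V] [Module K V]
    [FiniteDimensional K V] (T : Submodule K V) :
    ∃ (c : ℕ) (L : V →ₗ[K] Fin c → K), Function.Surjective L ∧ LinearMap.ker L = T := by
  let b := Module.finBasis K (V ⧸ T)
  exact ⟨_, b.equivFun.toLinearMap ∘ₗ T.mkQ, b.equivFun.surjective.comp T.mkQ_surjective, by
    rw [LinearEquiv.ker_comp, T.ker_mkQ]⟩

theorem isSubmanifoldAt_of_retraction {E : Type} [NormedAddCommGroup E] [NormedSpace ℂ E]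
    [FiniteDimensional ℂ E] {X : Set E} {x : E} {r : E → E} {D : E →L[ℂ] E} (hx : x ∈ X)
    (hr : HasStrictFDerivAt r D x) (hdiff : ∀ᶠ y in 𝓝 x, DifferentiableAt ℂ r y)
    (hmem : ∀ᶠ y in 𝓝 x, r y ∈ X) (hfix : ∀ᶠ y in 𝓝 x, y ∈ X → r y = y) :
    IsSubmanifoldAt X x (LinearMap.range (D : E →ₗ[ℂ] E)) := by
  have hrx : r x = x := hfix.self_of_nhds hx
  have htend : Tendsto r (𝓝 x) (𝓝 x) := by simpa only [hrx] using hr.continuousAt.tendsto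
  have hidem : ∀ᶠ y in 𝓝 x, r (r y) = r y := by
    filter_upwards [htend.eventually hfix, hmem] with y hy hyX using hy hyX
  have hD : IsIdempotentElem D :=
    isIdempotentElem_of_hasFDerivAt_retraction hr.hasFDerivAt hrx hidem
  obtain ⟨c, L₀, hsurj, hker⟩ := exists_surjective_ker_eq (LinearMap.range (D : E →ₗ[ℂ] E))
  let L : E →L[ℂ] Fin c → ℂ := L₀.toContinuousLinearMap
  have hL : ∀ v, L v = 0 ↔ D v = v := fun v => by
    refine (SetLike.ext_iff.mp hker v).trans ⟨?_, fun h => ⟨v, h⟩⟩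
    rintro ⟨u, rfl⟩
    exact DFunLike.congr_fun hD.eq u
  have hderiv : HasFDerivAt (fun y => L (y - r y)) L x := by
    refine (L.hasFDerivAt.comp x ((hasFDerivAt_id x).sub hr.hasFDerivAt)).congr_fderiv ?_
    refine ContinuousLinearMap.ext fun v => ?_
    have hLD : L (D v) = 0 := (hL _).mpr (DFunLike.congr_fun hD.eq v)
    simp [hLD]
  obtain ⟨U, hU, hUo, hxU⟩ := eventually_nhds_iff.mp (hdiff.and (hmem.and (hfix.and
    (eventually_eq_of_hasStrictFDerivAt_retraction hr hrx hidem))))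
  refine ⟨hx, c, U, fun y => L (y - r y), hUo, hxU, fun y hy => ?_, ?_, ?_, ?_⟩
  · exact (L.differentiableAt.comp y (differentiableAt_id.sub (hU y hy).1)).differentiableWithinAt
  · ext y
    refine ⟨fun ⟨hyX, hy⟩ => ⟨hy, ?_⟩, fun ⟨hy, hFy⟩ => ⟨?_, hy⟩⟩
    · change L (y - r y) = 0
      rw [(hU y hy).2.2.1 hyX, sub_self, map_zero]
    · rw [← (hU y hy).2.2.2 ((hL _).mp hFy)]
      exact (hU y hy).2.1
  · rw [hderiv.fderiv]
    exact hsurj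
  · rw [hderiv.fderiv]
    exact hker.symm

end Retraction

section Conjugation

open Topology

theorem hasStrictFDerivAt_conj {𝕜 A : Type*} [NontriviallyNormedField 𝕜] [NormedRing A]
    [NormedAlgebra 𝕜 A] [HasSummableGeomSeries A] (a : A) (u : Aˣ) :
    HasStrictFDerivAt (fun z => z * a * Ring.inverse z)
      (((ContinuousLinearMap.mul 𝕜 A).flip (u * a * (u⁻¹ : Aˣ)) -
        ContinuousLinearMap.mul 𝕜 A (u * a * (u⁻¹ : Aˣ))) ∘L
          (ContinuousLinearMap.mul 𝕜 A).flip (u⁻¹ : Aˣ)) (u : A) := by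
  refine (((hasStrictFDerivAt_id (𝕜 := 𝕜) (u : A)).mul_const' a).mul'
    (hasStrictFDerivAt_ringInverse (𝕜 := 𝕜) u)).congr_fderiv ?_
  ext v
  simp [mul_assoc, neg_add_eq_sub]

variable {n : ℕ}

theorem hasStrictFDerivAt_conj_matrix (A : Gl n) (u : GL (Fin n) ℂ) :
    HasStrictFDerivAt (fun M : Gl n => M * A * M⁻¹) (LinearMap.toContinuousLinearMap
      (infAction (u * A * ↑u⁻¹ : Gl n) ∘ₗ LinearMap.mulRight ℂ (↑u⁻¹ : Gl n))) (u : Gl n) := by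
  let normedRing : NormedRing (Gl n) := Matrix.linftyOpNormedRing
  let normedAlgebra : NormedAlgebra ℂ (Gl n) := Matrix.linftyOpNormedAlgebra
  have : @CompleteSpace (Gl n) normedRing.toUniformSpace := FiniteDimensional.complete ℂ (Gl n)
  simp only [nonsing_inv_eq_ringInverse]
  exact hasStrictFDerivAt_conj (𝕜 := ℂ) A u

variable {ι κ : Type} [Fintype ι] [Fintype κ]

theorem conj_mem_zeroFiber {A x : ι → Gl n} (hx : x ∈ zeroFiber A) {M : Gl n} (hM : IsUnit M) :
    (fun a => M * x a * M⁻¹) ∈ zeroFiber A := by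
  obtain ⟨u, rfl⟩ := hM
  refine ⟨fun a => ?_, ?_⟩
  · obtain ⟨g, hg⟩ := hx.1 a
    exact ⟨u * g, by simp [hg, mul_assoc]⟩
  · rw [momentMap, ← Finset.sum_mul, ← Finset.mul_sum, ← momentMap, hx.2, mul_zero, zero_mul]

/-- The matrix `∑ₐ fₐ eₐ` built from the completed families `e` of `x` and `f` of `y`. If both are
systems of orthogonal idempotents it satisfies `fₐ S = S eₐ`, hence conjugates `x` into `y` whenever
it is invertible. -/
def intertwiner (x y : Option κ → Gl n) : Gl n := ∑ a, completed y a * completed x a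

theorem intertwiner_self {x : Option κ → Gl n} (hx : CompleteOrthogonalIdempotents (completed x)) :
    intertwiner x x = 1 := by
  simp [intertwiner, (hx.idem _).eq, hx.complete]

theorem conj_intertwiner {x y : Option κ → Gl n} (hx : OrthogonalIdempotents (completed x))
    (hy : OrthogonalIdempotents (completed y)) (h : IsUnit (intertwiner x y)) (a : Option κ) :
    intertwiner x y * x a * (intertwiner x y)⁻¹ = y a := by
  have hcompleted : intertwiner x y * completed x a = completed y a * intertwiner x y := by
    rw [intertwiner, sum_mul_mul_of_orthogonalIdempotents hx,
      mul_sum_mul_of_orthogonalIdempotents hy]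
  have hxy : intertwiner x y * x a = y a * intertwiner x y := by
    cases a with
    | none => simpa [completed, mul_add, add_mul] using hcompleted
    | some i => exact hcompleted
  rw [hxy, mul_nonsing_inv_cancel_right _ _ ((isUnit_iff_isUnit_det _).mp h)]

/-- The linear part `w ↦ ∑ₐ wₐ eₐ` of the affine map `y ↦ intertwiner x y`. -/
def intertwinerDeriv (x : Option κ → Gl n) : (Option κ → Gl n) →ₗ[ℂ] Gl n :=
  (Fintype.linearCombination (Gl n) (completed x)).restrictScalars ℂ

theorem intertwinerDeriv_apply (x w : Option κ → Gl n) :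
    intertwinerDeriv x w = ∑ a, w a * completed x a := rfl

theorem hasStrictFDerivAt_intertwiner (x y : Option κ → Gl n) :
    HasStrictFDerivAt (intertwiner x) (intertwinerDeriv x).toContinuousLinearMap y := by
  have haffine : intertwiner x = fun z =>
      (intertwinerDeriv x).toContinuousLinearMap z + completed x none := by
    funext z
    simp only [intertwiner, Fintype.sum_option, completed, add_mul, one_mul,
      LinearMap.coe_toContinuousLinearMap', intertwinerDeriv_apply]
    abel
  exact haffine ▸ (intertwinerDeriv x).toContinuousLinearMap.hasStrictFDerivAt.add_const _

theorem eventually_isUnit_intertwiner {x : Option κ → Gl n}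
    (hx : CompleteOrthogonalIdempotents (completed x)) :
    ∀ᶠ y in 𝓝 x, IsUnit (intertwiner x y) := by
  have hdet : ContinuousAt (fun y => (intertwiner x y).det) x :=
    continuous_id.matrix_det.continuousAt.comp (hasStrictFDerivAt_intertwiner x x).continuousAt
  simpa only [isUnit_iff_isUnit_det, isUnit_iff_ne_zero] using
    hdet.eventually_ne (by simp [intertwiner_self hx])

theorem hasStrictFDerivAt_conj_intertwiner {x y : Option κ → Gl n} {u : GL (Fin n) ℂ}
    (hu : intertwiner x y = u) :
    HasStrictFDerivAt (fun z a => intertwiner x z * x a * (intertwiner x z)⁻¹)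
      (LinearMap.pi (fun a => infAction (u * x a * ↑u⁻¹ : Gl n) ∘ₗ
        LinearMap.mulRight ℂ (↑u⁻¹ : Gl n)) ∘ₗ
          intertwinerDeriv x).toContinuousLinearMap y := by
  refine hasStrictFDerivAt_pi'.mpr fun a => ?_
  have hconj := hasStrictFDerivAt_conj_matrix (x a) u
  rw [← hu] at hconj
  exact (hconj.comp y (hasStrictFDerivAt_intertwiner x y)).congr_fderiv
    (hu ▸ ContinuousLinearMap.ext fun _ => rfl)

theorem range_diagAction_comp_intertwinerDeriv {x : Option κ → Gl n} (hx : momentMap x = 0)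
    (he : OrthogonalIdempotents (completed x)) :
    (diagAction x ∘ₗ intertwinerDeriv x).range = (diagAction x).range := by
  refine le_antisymm (LinearMap.range_comp_le_range _ _) ?_
  rintro _ ⟨ξ, rfl⟩
  refine ⟨(diagAction x ξ).1, Subtype.ext (funext (infAction_sum_mul_completed he
    (diagAction x ξ).2 ?_))⟩
  simp [momentMap_diagAction, hx, infAction]

theorem isSubmanifoldAt_zeroFiber {A x : Option κ → Gl n} (hx : x ∈ zeroFiber A)
    (hA : ∀ y ∈ zeroFiber A, CompleteOrthogonalIdempotents (completed y)) :
    IsSubmanifoldAt (zeroFiber A) x ((diagAction x).range.map (prodTangent x).subtype) := by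
  have hunit : ∀ᶠ y in 𝓝 x, IsUnit (intertwiner x y) := eventually_isUnit_intertwiner (hA x hx)
  have hr := hasStrictFDerivAt_conj_intertwiner (u := 1) (intertwiner_self (hA x hx))
  convert isSubmanifoldAt_of_retraction hx hr ?_ ?_ ?_
  · rw [← range_diagAction_comp_intertwinerDeriv hx.2 (hA x hx).1, ← LinearMap.range_comp]
    congr 1
    ext w a : 2
    simp only [Units.val_one, inv_one, one_mul, mul_one, LinearMap.comp_apply,
      LinearMap.pi_apply, LinearMap.mulRight_apply, LinearMap.coe_toContinuousLinearMap]
    rfl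
  · filter_upwards [hunit] with y ⟨u, hu⟩
    exact (hasStrictFDerivAt_conj_intertwiner hu.symm).hasFDerivAt.differentiableAt
  · filter_upwards [hunit] with y hy using conj_mem_zeroFiber hx hy
  · filter_upwards [hunit] with y hy hyA
    exact funext (conj_intertwiner (hA x hx).1 (hA y hyA).1 hy)

end Conjugation

section ZariskiClosed

open MvPolynomial

variable {n : ℕ} {ι κ : Type}

theorem isZariskiClosed_iInter {J : Sort*} {X : J → Set (ι → Gl n)}
    (hX : ∀ j, IsZariskiClosed (X j)) : IsZariskiClosed (⋂ j, X j) := by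
  choose S hS using hX
  refine ⟨⋃ j, S j, Set.ext fun x => ?_⟩
  simp only [hS, Set.mem_iInter, Set.mem_ofPred_eq, Set.mem_iUnion, forall_exists_index]
  exact forall_comm

theorem isZariskiClosed_inter {X Y : Set (ι → Gl n)} (hX : IsZariskiClosed X)
    (hY : IsZariskiClosed Y) : IsZariskiClosed (X ∩ Y) := by
  rw [Set.inter_eq_iInter]
  exact isZariskiClosed_iInter (Bool.rec hY hX)

theorem isZariskiClosed_eval_eq_zero (f : MvPolynomial (ι × Fin n × Fin n) ℂ) :
    IsZariskiClosed {x : ι → Gl n | eval (fun c => x c.1 c.2.1 c.2.2) f = 0} :=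
  ⟨{f}, by simp⟩

theorem isZariskiClosed_mapMatrix_eval_eq_zero
    (M : Matrix (Fin n) (Fin n) (MvPolynomial (ι × Fin n × Fin n) ℂ)) :
    IsZariskiClosed
      {x : ι → Gl n | (eval fun c => x c.1 c.2.1 c.2.2).mapMatrix M = 0} := by
  simp only [← Matrix.ext_iff, Set.ofPred_forall]
  exact isZariskiClosed_iInter fun s => isZariskiClosed_iInter fun t =>
    isZariskiClosed_eval_eq_zero (M s t)

/-- The matrix of coordinate functions of the component `a` of a family of matrices. -/
def genericMatrix (a : ι) : Matrix (Fin n) (Fin n) (MvPolynomial (ι × Fin n × Fin n) ℂ) :=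
  of fun s t => X (a, s, t)

theorem mapMatrix_eval_genericMatrix (x : ι → Gl n) (a : ι) :
    (eval fun c => x c.1 c.2.1 c.2.2).mapMatrix (genericMatrix a) = x a := by
  ext s t
  simp [genericMatrix]

theorem isZariskiClosed_mul_eq [DecidableEq ι] (a b : ι) :
    IsZariskiClosed {x : ι → Gl n | x a * x b = if a = b then x a else 0} := by
  have h := isZariskiClosed_mapMatrix_eval_eq_zero (n := n)
    (genericMatrix a * genericMatrix b - if a = b then genericMatrix a else 0)
  split_ifs at h ⊢ <;>
    simpa only [map_sub, map_mul, map_zero, mapMatrix_eval_genericMatrix, sub_eq_zero] using h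

theorem isZariskiClosed_trace_eq (a : ι) (c : ℂ) :
    IsZariskiClosed {x : ι → Gl n | (x a).trace = c} := by
  have h := isZariskiClosed_eval_eq_zero ((genericMatrix (n := n) a).trace - C c)
  simpa [Matrix.trace, genericMatrix, sub_eq_zero] using h

theorem isZariskiClosed_momentMap_eq_zero [Fintype ι] :
    IsZariskiClosed {x : ι → Gl n | momentMap x = 0} := by
  have h := isZariskiClosed_mapMatrix_eval_eq_zero (n := n) (∑ a : ι, genericMatrix a)
  simpa only [momentMap, map_sum, mapMatrix_eval_genericMatrix] using h

end ZariskiClosed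

section OrthogonalSystems

variable {n k : ℕ} {κ : Type} [Fintype κ]

/-- Systems of pairwise orthogonal projectors `qᵢ` of rank `r i`, together with minus their sum:
the analogue of `orthogonalSystems` for projectors of arbitrary ranks. -/
def orthogonalSystemsOfRank (n : ℕ) (r : κ → ℕ) : Set (Option κ → Gl n) :=
  {x | momentMap x = 0 ∧ OrthogonalIdempotents (fun i => x (some i)) ∧
    ∀ i, (x (some i)).rank = r i}

theorem orthogonalSystems_eq_orthogonalSystemsOfRank :
    orthogonalSystems n k = orthogonalSystemsOfRank n fun _ : Fin k => 1 := by
  ext x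
  constructor
  · rintro ⟨q, hq, horth, rfl⟩
    exact ⟨momentMap_eq_zero_iff.mpr rfl, ⟨fun i => (hq i).1, horth⟩, fun i => (hq i).2⟩
  · rintro ⟨hx, hq, hrank⟩
    refine ⟨fun i => x (some i), fun i => ⟨hq.idem i, hrank i⟩, hq.ortho, funext ?_⟩
    rintro (_ | i)
    exacts [momentMap_eq_zero_iff.mp hx, rfl]

theorem nonempty_orthogonalSystemsOfRank {r : Fin k → ℕ} (hr : ∑ i, r i ≤ n) :
    (orthogonalSystemsOfRank n r).Nonempty := by
  obtain ⟨q, hq, hrank⟩ := exists_orthogonalIdempotents_rank_eq (K := ℂ) (m := Fin n)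
    (hr.trans_eq (Fintype.card_fin n).symm)
  exact ⟨withNeg q (∑ i, q i), momentMap_eq_zero_iff.mpr rfl, hq, hrank⟩

theorem isZariskiClosed_orthogonalSystemsOfRank (r : κ → ℕ) :
    IsZariskiClosed (orthogonalSystemsOfRank n r) := by
  classical
  have hset : orthogonalSystemsOfRank n r = {x | momentMap x = 0} ∩
      ((⋂ i, ⋂ j, {x | x (some i) * x (some j) = if some i = some j then x (some i) else 0}) ∩
        ⋂ i, {x | (x (some i)).trace = (r i : ℂ)}) := by
    ext x
    simp only [Set.mem_inter_iff, Set.mem_iInter, Set.mem_ofPred_eq, Option.some_inj]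
    refine and_congr_right' ⟨fun ⟨hq, hrank⟩ => ⟨hq.mul_eq, fun i => ?_⟩,
      fun ⟨hmul, htrace⟩ => ?_⟩
    · rw [trace_eq_rank_of_isIdempotentElem (hq.idem i), hrank]
    · have hidem : ∀ i, IsIdempotentElem (x (some i)) := fun i => (hmul i i).trans (if_pos rfl)
      refine ⟨⟨hidem, fun i j hij => by simpa [hij] using hmul i j⟩, fun i => ?_⟩
      exact_mod_cast (trace_eq_rank_of_isIdempotentElem (hidem i)).symm.trans (htrace i)
  rw [hset]
  exact isZariskiClosed_inter isZariskiClosed_momentMap_eq_zero <| isZariskiClosed_inter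
    (isZariskiClosed_iInter fun i => isZariskiClosed_iInter fun j => isZariskiClosed_mul_eq _ _)
    (isZariskiClosed_iInter fun i => isZariskiClosed_trace_eq _ _)

end OrthogonalSystems

section ZeroFiber

variable {n k : ℕ}

theorem mem_orbit_iff_isConj {A B : Gl n} : B ∈ orbit A ↔ IsConj A B :=
  exists_congr fun g => Units.eq_mul_inv_iff_mul_eq g |>.trans eq_comm

theorem neg_mem_orbit_neg_iff {A B : Gl n} : -B ∈ orbit (-A) ↔ B ∈ orbit A := by
  simp [orbit]

theorem zeroFiber_withNeg_eq_orthogonalSystemsOfRank {p : Fin k → Gl n} {P : Gl n}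
    (hp : ∀ i, IsIdempotentElem (p i)) (hP : IsIdempotentElem P)
    (hrank : P.rank = ∑ i, (p i).rank) :
    zeroFiber (withNeg p P) = orthogonalSystemsOfRank n fun i => (p i).rank := by
  ext x
  refine and_comm.trans (and_congr_right fun hx => Option.forall.trans ?_)
  rw [momentMap_eq_zero_iff.mp hx]
  simp only [withNeg, neg_mem_orbit_neg_iff]
  simp only [mem_orbit_iff_isConj, isConj_iff_of_isIdempotentElem hP,
    isConj_iff_of_isIdempotentElem (hp _)]
  constructor
  · rintro ⟨⟨hsum, -⟩, hq⟩
    exact ⟨orthogonalIdempotents_matrix_of_isIdempotentElem_sum (fun i => (hq i).1) hsum,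
      fun i => (hq i).2⟩
  · rintro ⟨hq, hqrank⟩
    have hsum : IsIdempotentElem (∑ i, x (some i)) := hq.isIdempotentElem_sum
    refine ⟨⟨hsum, ?_⟩, fun i => ⟨hq.idem i, hqrank i⟩⟩
    rw [rank_sum_of_isIdempotentElem hq.idem hsum, hrank, Finset.sum_congr rfl fun i _ => hqrank i]

end ZeroFiber

end CoadjointOrbits

end

open CoadjointOrbits in
theorem mainTheorem6_general {n k : ℕ} {p : Fin k → Gl n} {P : Gl n}
    (hp : ∀ i, IsIdempotentElem (p i)) (hP : IsIdempotentElem P)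
    (hrank : P.rank = ∑ i, (p i).rank) :
    zeroFiber (withNeg p P) = orthogonalSystemsOfRank n (fun i => (p i).rank) ∧
      (zeroFiber (withNeg p P)).Nonempty ∧
      IsLagrangianSubvariety (withNeg p P) (zeroFiber (withNeg p P)) := by
  have hfiber := zeroFiber_withNeg_eq_orthogonalSystemsOfRank hp hP hrank
  have hle : ∑ i, (p i).rank ≤ n := by
    rw [← hrank]
    exact Matrix.rank_le_width P
  have hcomplete : ∀ x ∈ zeroFiber (withNeg p P), CompleteOrthogonalIdempotents (completed x) :=
    fun x hx => completeOrthogonalIdempotents_completed hx.2 (hfiber ▸ hx).2.1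
  exact ⟨hfiber, hfiber ▸ nonempty_orthogonalSystemsOfRank hle,
    { subset := fun _ hx => hx.1
      closed := hfiber ▸ isZariskiClosed_orthogonalSystemsOfRank _
      lagrangian := fun x hx => ⟨_, isSubmanifoldAt_zeroFiber hx hcomplete,
        isLagrangianSubspace_of_orthogonalIdempotents hx.2 (hcomplete x hx).1⟩ }⟩

theorem mainTheorem6 (n k : ℕ) (hk : 1 ≤ k) (hkn : k ≤ n)
    (p : Fin k → Matrix (Fin n) (Fin n) ℂ) (P : Matrix (Fin n) (Fin n) ℂ)
    (hp : ∀ i, p i * p i = p i) (hp1 : ∀ i, (p i).rank = 1)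
    (hP : P * P = P) (hPk : P.rank = k) :
    CoadjointOrbits.zeroFiber (CoadjointOrbits.withNeg p P) =
        CoadjointOrbits.orthogonalSystems n k ∧
      (CoadjointOrbits.zeroFiber (CoadjointOrbits.withNeg p P)).Nonempty ∧
      CoadjointOrbits.IsLagrangianSubvariety (CoadjointOrbits.withNeg p P)
        (CoadjointOrbits.zeroFiber (CoadjointOrbits.withNeg p P)) := by
  rw [CoadjointOrbits.orthogonalSystems_eq_orthogonalSystemsOfRank, ← funext hp1]
  exact mainTheorem6_general hp hP (by simp [hp1, hPk])
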